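/- Let $q,a,b$ be real with $|q|<1$ and $|b|<|a|$. Put $[n]_q=1+q+\dots+q^{n-1}$, $[n]_q!=\prod_{j=1}^n[j]_q$, $(c)_\infty=\prod_{k\ge0}(1-cq^k)$ and $S(q)=[-2/\sqrt{1-q},\,2/\sqrt{1-q}]$. Let $H_n(x|a,q)$ be the big $q$-Hermite polynomials, defined by $H_{-1}=0$, $H_0=1$ and $$H_{n+1}(x|a,q)=(x-aq^n)H_n(x|a,q)-[n]_qH_{n-1}(x|a,q)\qquad(n\ge0);$$ equivalently $H_n(x|a,q)=(1-q)^{-n/2}h_n\bigl(\tfrac{x\sqrt{1-q}}2\,\big|\,a\sqrt{1-q},q\bigr)$, where $h_{-1}=0$, $h_0=1$ and $(2x-aq^n)h_n(x|a,q)=h_{n+1}(x|a,q)+(1-q^n)h_{n-1}(x|a,q)$. Let $$V_q(x|c)=1-(1-q)cx+(1-q)c^2,\qquad W_q(x,y|t)=(1-t^2)^2-(1-q)xyt(1+t^2)+(1-q)t^2(x^2+y^2).$$ Then for all $x,y\in S(q)$ the series and the infinite products below converge, every $W_q\bigl(x,y\,|\,\tfrac ba q^k\bigr)$ with $k\ge0$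 is nonzero, and $$0\le\sum_{n\ge0}\frac{b^n}{[n]_q!\,a^n}H_n(x|a,q)H_n(y|b,q)=\Bigl(\frac{b^2}{a^2}\Bigr)_\infty\prod_{k=0}^\infty\frac{V_q(y\,|\,bq^k)}{W_q\bigl(x,y\,|\,\tfrac ba q^k\bigr)}.$$ -/

import Mathlib

noncomputable section

namespace BigQHermite

/-- The interval `S(q) = [-2/√(1-q), 2/√(1-q)]`. -/
def S (q : ℝ) : Set ℝ := Set.Icc (-2 / √(1 - q)) (2 / √(1 - q))

/-- The `q`-number `[n]_q = 1 + q + ... + q^(n-1)`, with `[0]_q = 0`. -/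
def qNumber (q : ℝ) (n : ℕ) : ℝ := ∑ i ∈ Finset.range n, q ^ i

/-- The `q`-factorial `[n]_q! = [1]_q [2]_q ... [n]_q`, with `[0]_q! = 1`. -/
def qFactorial (q : ℝ) (n : ℕ) : ℝ := ∏ j ∈ Finset.range n, qNumber q (j + 1)

/-- The infinite `q`-Pochhammer symbol `(a)_∞ = ∏_{k ≥ 0} (1 - a q^k)`. -/
def qPochhammerInf (a q : ℝ) : ℝ := ∏' k : ℕ, (1 - a * q ^ k)

/-- The big continuous `q`-Hermite polynomials `h_n(x|a,q)` supported on `[-1,1]`: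
`h_{-1} = 0`, `h_0 = 1`, `h_{n+1} = (2x - a q^n) h_n - (1 - q^n) h_{n-1}`. -/
def littleH (a q x : ℝ) : ℕ → ℝ
  | 0 => 1
  | 1 => 2 * x - a
  | n + 2 => (2 * x - a * q ^ (n + 1)) * littleH a q x (n + 1)
      - (1 - q ^ (n + 1)) * littleH a q x n

/-- The big `q`-Hermite polynomials rescaled to `S(q)`:
`H_n(x|a,q) = (1-q)^(-n/2) h_n(x√(1-q)/2 | a√(1-q), q)`, i.e. the monic polynomials with
`H_{n+1} = (x - a q^n) H_n - [n]_q H_{n-1}`, `H_{-1} = 0`, `H_0 = 1`. -/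
def bigH (n : ℕ) (x a q : ℝ) : ℝ :=
  (√(1 - q) ^ n)⁻¹ * littleH (a * √(1 - q)) q (x * √(1 - q) / 2) n

/-- `v(x|a) = 1 - 2ax + a²`. -/
def v (x a : ℝ) : ℝ := 1 - 2 * a * x + a ^ 2

/-- `w(x,y|a) = (1-a²)² - 4xya(1+a²) + 4a²(x²+y²)`. -/
def w (x y a : ℝ) : ℝ :=
  (1 - a ^ 2) ^ 2 - 4 * x * y * a * (1 + a ^ 2) + 4 * a ^ 2 * (x ^ 2 + y ^ 2)

/-- `V_q(x|a) = v(x√(1-q)/2 | a√(1-q)) = 1 - (1-q)ax + (1-q)a²` for `q ≤ 1`. -/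
def V (q x a : ℝ) : ℝ := v (x * √(1 - q) / 2) (a * √(1 - q))

/-- `W_q(x,y|t) = w(x√(1-q)/2, y√(1-q)/2 | t)
= (1-t²)² - (1-q)xyt(1+t²) + (1-q)t²(x²+y²)` for `q ≤ 1`. -/
def W (q x y t : ℝ) : ℝ := w (x * √(1 - q) / 2) (y * √(1 - q) / 2) t

/-- The `n`-th term `b^n / ([n]_q! a^n) H_n(x|a,q) H_n(y|b,q)` of the kernel. -/
def kernelTerm (q a b x y : ℝ) (n : ℕ) : ℝ :=
  b ^ n / (qFactorial q n * a ^ n) * bigH n x a q * bigH n y b q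

end BigQHermite

end

noncomputable section

namespace BigQHermite

open Filter Topology

/-! ### The recurrence and the shift of the parameter -/

/-! After rescaling to `[-1,1]`, the kernel is `F(t;a,b) = ∑ t^n/(q;q)_n h_n(x|a,q) h_n(y|b,q)` at
`t = b/a`, hence on the locus `b = t a`. There two functional equations hold: `F(t;a,ta) = v(y|ta)
F(t;aq,taq)` (`bilinearSum_shift`) and `w(x,y|t) F(t;0,0) = (1-t²)(1-t²q) F(tq;0,0)`
(`bilinearSum_zero_shift`). Iterating the first sends both parameters to `0` and produces the
product of the `v`; iterating the second sends `t` to `0`, where `F = 1`, and gives the `q`-Mehler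
formula.

The limits are taken by dominated convergence (`tendsto_bilinearSum`). The majorant comes from
`abs_littleH_le`: on `[-1,1]` the `h_n` grow at most like `(1+δ)^n` for every small `δ > 0`,
uniformly in bounded parameters, so `|t| < 1` suffices. Nonnegativity is read off the product, all
of whose factors are nonnegative. -/

lemma littleH_succ (a q x : ℝ) (n : ℕ) :
    littleH a q x (n + 1) =
      (2 * x - a * q ^ n) * littleH a q x n - (1 - q ^ n) * littleH a q x (n - 1) := by
  cases n with
  | zero => simp [littleH]
  | succ n => simp [littleH]

/-- The generating function of `h_n/(q;q)_n` in `s` has numerator `∏ (1 - a s q^k)`; splitting off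
the factor `1 - a s` replaces `a` by `a q`. At `n = 0` the truncated index `n - 1` is harmless,
since `1 - q^0 = 0`. -/
lemma littleH_eq_shift (a q x : ℝ) (n : ℕ) :
    littleH a q x n =
      littleH (a * q) q x n - a * (1 - q ^ n) * littleH (a * q) q x (n - 1) := by
  induction n using Nat.twoStepInduction with
  | zero => simp [littleH]
  | one => simp [littleH]; ring
  | more n h0 h1 =>
    have e0 := littleH_succ (a * q) q x n
    have e1 := littleH_succ (a * q) q x (n + 1)
    rw [littleH_succ a q x (n + 1), h1]
    simp only [Nat.add_sub_cancel] at *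
    rw [show n + 2 - 1 = n + 1 by omega, h0, e1]
    linear_combination a * (1 - q ^ (n + 1)) * e0

lemma continuous_littleH (q x : ℝ) (n : ℕ) : Continuous fun a => littleH a q x n := by
  induction n using Nat.twoStepInduction with
  | zero => simpa [littleH] using continuous_const
  | one => simp only [littleH]; fun_prop
  | more n h0 h1 => simp only [littleH]; fun_prop

/-! ### Growth of the polynomials on `[-1, 1]` -/

/-- A majorant of `|h_n(x|a,q)|` for `|x| ≤ 1`, `|a| ≤ A`; its growth rate is `1 + δ`. -/
def growthBound (q δ A : ℝ) (n : ℕ) : ℝ :=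
  ((1 + δ) * (2 + A) + 1) / δ * ∏ j ∈ Finset.range n, (1 + δ) * (1 + (A + 1) / δ * |q| ^ j)

lemma growthBound_succ (q δ A : ℝ) (n : ℕ) :
    growthBound q δ A (n + 1) =
      growthBound q δ A n * ((1 + δ) * (1 + (A + 1) / δ * |q| ^ n)) := by
  rw [growthBound, growthBound, Finset.prod_range_succ, mul_assoc]

lemma growthBound_pos {q δ A : ℝ} (hδ : 0 < δ) (hA : 0 ≤ A) (n : ℕ) :
    0 < growthBound q δ A n :=
  mul_pos (by positivity) (Finset.prod_pos fun j _ => by positivity)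

lemma growthBound_mono {q δ A : ℝ} (hδ : 0 < δ) (hA : 0 ≤ A) : Monotone (growthBound q δ A) := by
  refine monotone_nat_of_le_succ fun n => ?_
  rw [growthBound_succ]
  refine le_mul_of_one_le_right (growthBound_pos hδ hA n).le ?_
  have : 0 ≤ (A + 1) / δ * |q| ^ n := by positivity
  nlinarith

/-- `u` and `w` are `e^{±iθ}` with `x = cos θ`, the characteristic roots of the limiting recurrence
`h_{n+2} = 2x h_{n+1} - h_n`. -/
lemma exists_unit_complex {x : ℝ} (hx : |x| ≤ 1) :
    ∃ u w : ℂ, ‖u‖ = 1 ∧ ‖w‖ = 1 ∧ u + w = 2 * x ∧ u * w = 1 := by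
  obtain ⟨h1, h2⟩ := abs_le.1 hx
  refine ⟨Complex.exp (Real.arccos x * Complex.I), Complex.exp (-Real.arccos x * Complex.I),
    Complex.norm_exp_ofReal_mul_I _, ?_, ?_, ?_⟩
  · rw [← Complex.ofReal_neg]; exact Complex.norm_exp_ofReal_mul_I _
  · have := Complex.two_cos (x := (Real.arccos x : ℂ))
    rw [← this, ← Complex.ofReal_cos, Real.cos_arccos h1 h2]
  · rw [← Complex.exp_add]; simp

/-- Put `d_n = h_{n+1} - u h_n`. Up to `O(|q|^n)` errors, `d` is rotated by `w` and `h` by `u` with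
`d` added. At `x = ±1` the roots coincide and growth can be linear, so the norm `δ|h| + |d|` is
used: each step multiplies it by at most `1 + δ`, up to a factor whose product over all steps
converges. -/
lemma abs_littleH_le {q δ A a x : ℝ} (hδ : 0 < δ) (hδ1 : δ ≤ 1)
    (hA : |a| ≤ A) (hx : |x| ≤ 1) (n : ℕ) :
    |littleH a q x n| ≤ growthBound q δ A n := by
  have hA0 : 0 ≤ A := (abs_nonneg a).trans hA
  obtain ⟨u, w, hu, hw, huw, huw1⟩ := exists_unit_complex hx
  set h : ℕ → ℂ := fun n => (littleH a q x n : ℂ) with hh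
  have key : ∀ n, δ * ‖h (n + 1)‖ + ‖h (n + 1) - u * h n‖ ≤ δ * growthBound q δ A (n + 1) := by
    intro n
    induction n with
    | zero =>
      have e1 : ‖h 1‖ ≤ 2 + A := by
        simp only [hh, Complex.norm_real, Real.norm_eq_abs, littleH]
        refine (abs_sub _ _).trans (add_le_add ?_ hA)
        rw [abs_mul, abs_two]; linarith
      have e2 : ‖h 1 - u * h 0‖ ≤ ‖h 1‖ + 1 := by
        refine (norm_sub_le _ _).trans ?_
        simp [hu, hh, littleH]
      -- The prefactor of `growthBound` is chosen to cover this base case.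
      have e3 : δ * growthBound q δ A 0 = (1 + δ) * (2 + A) + 1 := by
        simp [growthBound]; field_simp
      have e4 := mul_le_mul_of_nonneg_left
        (growthBound_mono (q := q) hδ hA0 (Nat.zero_le 1)) hδ.le
      simp only [zero_add]
      nlinarith
    | succ n ih =>
      have rec' : h (n + 2) = (2 * x - a * q ^ (n + 1)) * h (n + 1)
          - (1 - q ^ (n + 1)) * h n := by
        simp only [hh]; rw [littleH_succ a q x (n + 1)]; push_cast; simp
      have dn : h (n + 2) - u * h (n + 1) = w * (h (n + 1) - u * h n)
          + (q : ℂ) ^ (n + 1) * (w * (h (n + 1) - (h (n + 1) - u * h n))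
            - a * h (n + 1)) := by
        rw [rec', ← huw]; linear_combination h n * (q ^ (n + 1) - 1) * (-huw1)
      set d := h (n + 1) - u * h n with hd
      set Q := |q| ^ (n + 1)
      have hQ : 0 ≤ Q := by positivity
      have b1 : ‖h (n + 2) - u * h (n + 1)‖ ≤ ‖d‖ + Q * ((‖h (n + 1)‖ + ‖d‖) + A * ‖h (n + 1)‖) := by
        rw [dn]
        refine (norm_add_le _ _).trans (add_le_add (by rw [norm_mul, hw, one_mul]) ?_)
        rw [norm_mul, norm_pow, Complex.norm_real, Real.norm_eq_abs]
        refine mul_le_mul_of_nonneg_left ((norm_sub_le _ _).trans (add_le_add ?_ ?_)) hQ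
        · rw [norm_mul, hw, one_mul]; exact norm_sub_le _ _
        · rw [norm_mul, Complex.norm_real, Real.norm_eq_abs]; gcongr
      have b2 : ‖h (n + 2)‖ ≤ ‖h (n + 1)‖ + ‖h (n + 2) - u * h (n + 1)‖ := by
        have := norm_add_le (u * h (n + 1)) (h (n + 2) - u * h (n + 1))
        rwa [add_sub_cancel, norm_mul, hu, one_mul] at this
      rw [growthBound_succ]
      set c := (A + 1) / δ with hc
      have hcδ : c * δ = A + 1 := by rw [hc]; field_simp
      have hc1 : 1 ≤ c := by rw [hc, one_le_div hδ]; linarith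
      have hμ : 0 ≤ (1 + δ) * (1 + c * Q) := by positivity
      have step := mul_le_mul_of_nonneg_right ih hμ
      have n1 := norm_nonneg (h (n + 1))
      have n2 := norm_nonneg d
      have b3 : δ * ‖h (n + 2)‖ + ‖h (n + 2) - u * h (n + 1)‖ ≤
          δ * ‖h (n + 1)‖ + (1 + δ) * (‖d‖ + Q * ((‖h (n + 1)‖ + ‖d‖) + A * ‖h (n + 1)‖)) := by
        nlinarith
      have b4 : δ * ‖h (n + 1)‖ + (1 + δ) * (‖d‖ + Q * ((‖h (n + 1)‖ + ‖d‖) + A * ‖h (n + 1)‖))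
          ≤ (δ * ‖h (n + 1)‖ + ‖d‖) * ((1 + δ) * (1 + c * Q)) := by
        have e : (δ * ‖h (n + 1)‖ + ‖d‖) * ((1 + δ) * (1 + c * Q)) -
            (δ * ‖h (n + 1)‖ + (1 + δ) * (‖d‖ + Q * ((‖h (n + 1)‖ + ‖d‖) + A * ‖h (n + 1)‖)))
            = δ * δ * ‖h (n + 1)‖ + (1 + δ) * ((c - 1) * Q * ‖d‖) := by
          linear_combination (1 + δ) * Q * ‖h (n + 1)‖ * hcδ
        have : 0 ≤ δ * δ * ‖h (n + 1)‖ + (1 + δ) * ((c - 1) * Q * ‖d‖) := by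
          have := sub_nonneg.2 hc1
          positivity
        linarith
      calc _ ≤ _ := b3
        _ ≤ _ := b4
        _ ≤ _ := step
        _ = _ := by ring
  cases n with
  | zero =>
    simp only [littleH, growthBound, abs_one, Finset.range_zero, Finset.prod_empty, mul_one]
    rw [le_div_iff₀ hδ]; nlinarith
  | succ n =>
    have := key n
    have h2 := norm_nonneg (h (n + 1) - u * h n)
    have h3 : ‖h (n + 1)‖ = |littleH a q x (n + 1)| := by simp [hh]
    rw [← h3]
    exact le_of_mul_le_mul_left (by linarith) hδ

/-! ### The coefficients `t^n / (q;q)_n` -/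

/-- The coefficient `t^n / (q;q)_n`. -/
def qExpCoeff (q t : ℝ) (n : ℕ) : ℝ := t ^ n / ∏ j ∈ Finset.range n, (1 - q ^ (j + 1))

lemma one_sub_pow_succ_ne_zero {q : ℝ} (hq : |q| < 1) (n : ℕ) : 1 - q ^ (n + 1) ≠ 0 := by
  intro h
  have : |q| ^ (n + 1) < 1 := pow_lt_one₀ (abs_nonneg q) hq n.succ_ne_zero
  rw [← abs_pow, ← sub_eq_zero.1 h] at this
  simp at this

lemma qExpCoeff_succ {q : ℝ} (hq : |q| < 1) (t : ℝ) (n : ℕ) :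
    qExpCoeff q t (n + 1) * (1 - q ^ (n + 1)) = t * qExpCoeff q t n := by
  have h := one_sub_pow_succ_ne_zero hq n
  have h' : ∏ j ∈ Finset.range n, (1 - q ^ (j + 1)) ≠ 0 :=
    Finset.prod_ne_zero_iff.2 fun j _ => one_sub_pow_succ_ne_zero hq j
  rw [qExpCoeff, qExpCoeff, Finset.prod_range_succ]
  field_simp
  ring

lemma qExpCoeff_mul (q t s : ℝ) (n : ℕ) : qExpCoeff q (t * s) n = qExpCoeff q t n * s ^ n := by
  rw [qExpCoeff, qExpCoeff, mul_pow]; ring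

/-- The factor `1 - q^n` cancels the last factor of `(q;q)_n` and kills the term `n = 0`, so
lowering the index costs exactly one `t`. -/
lemma hasSum_shift {q t s : ℝ} (hq : |q| < 1) {F : ℕ → ℝ}
    (h : HasSum (fun n => qExpCoeff q t n * F n) s) :
    HasSum (fun n => qExpCoeff q t n * ((1 - q ^ n) * F (n - 1))) (t * s) := by
  rw [← hasSum_nat_add_iff' 1]
  simp only [Finset.range_one, Finset.sum_singleton, pow_zero, sub_self, zero_mul, mul_zero,
    sub_zero, Nat.add_sub_cancel]
  refine (h.mul_left t).congr_fun fun n => ?_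
  rw [← mul_assoc, qExpCoeff_succ hq, mul_assoc]

lemma tendsto_pow_succ_zero {q : ℝ} (hq : |q| < 1) (m : ℕ) :
    Tendsto (fun n : ℕ => q ^ (n + m)) atTop (𝓝 0) :=
  (tendsto_add_atTop_iff_nat m).2 (tendsto_pow_atTop_nhds_zero_of_abs_lt_one hq)

lemma summable_majorant {q t δ A : ℝ} (hq : |q| < 1) (hδ : 0 < δ) (hA : 0 ≤ A)
    (ht : |t| * (1 + δ) ^ 2 < 1) :
    Summable fun n => |qExpCoeff q t n| * growthBound q δ A (n + 2) ^ 2 := by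
  -- The ratio test below needs nonzero terms; its limiting ratio is `|t|(1+δ)²`.
  rcases eq_or_ne t 0 with rfl | ht0
  · refine summable_of_ne_finset_zero (s := {0}) fun n hn => ?_
    simp only [Finset.mem_singleton] at hn
    simp [qExpCoeff, hn]
  have hprod : ∀ n, ∏ j ∈ Finset.range n, (1 - q ^ (j + 1)) ≠ 0 := fun n =>
    Finset.prod_ne_zero_iff.2 fun j _ => one_sub_pow_succ_ne_zero hq j
  have hc : ∀ n, qExpCoeff q t n ≠ 0 := fun n => div_ne_zero (pow_ne_zero n ht0) (hprod n)
  have hK := fun n => (growthBound_pos (q := q) hδ hA n).ne'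
  refine summable_of_ratio_test_tendsto_lt_one ht
    (Eventually.of_forall fun n => mul_ne_zero (abs_ne_zero.2 (hc n)) (pow_ne_zero 2 (hK _))) ?_
  have lim : Tendsto (fun n : ℕ => |t| / |1 - q ^ (n + 1)| *
      ((1 + δ) * (1 + (A + 1) / δ * |q| ^ (n + 2))) ^ 2) atTop
      (𝓝 (|t| / |1 - 0| * ((1 + δ) * (1 + (A + 1) / δ * 0)) ^ 2)) := by
    have h1 := tendsto_pow_succ_zero hq 1
    have h2 := tendsto_pow_succ_zero (q := |q|) (by rwa [abs_abs]) 2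
    refine Tendsto.mul (Tendsto.div tendsto_const_nhds (h1.const_sub 1).abs (by simp)) ?_
    exact (((h2.const_mul _).const_add 1).const_mul _).pow 2
  simp only [sub_zero, abs_one, div_one, mul_zero, add_zero, mul_one] at lim
  refine lim.congr fun n => ?_
  have e : qExpCoeff q t (n + 1) = t * qExpCoeff q t n / (1 - q ^ (n + 1)) := by
    rw [eq_div_iff (one_sub_pow_succ_ne_zero hq n), qExpCoeff_succ hq]
  rw [show n + 1 + 2 = (n + 2) + 1 by omega, growthBound_succ, e, norm_mul, norm_mul, norm_pow,
    norm_pow, Real.norm_eq_abs, Real.norm_eq_abs, Real.norm_eq_abs, Real.norm_eq_abs, abs_abs,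
    abs_abs, abs_div, abs_mul, abs_mul,
    abs_of_nonneg (show 0 ≤ (1 + δ) * (1 + (A + 1) / δ * |q| ^ (n + 2)) by positivity), mul_pow]
  have h1 := abs_ne_zero.2 (hc n)
  have h2 := abs_ne_zero.2 (hK (n + 2))
  have h3 := abs_ne_zero.2 (one_sub_pow_succ_ne_zero hq n)
  field_simp

/-- A summable majorant of the bilinear sums, uniform in the parameters. -/
lemma exists_majorant {q t : ℝ} (hq : |q| < 1) (ht : |t| < 1) {A : ℝ} (hA : 0 ≤ A) :
    ∃ D : ℕ → ℝ, Summable D ∧ ∀ a b x y s : ℝ, |a| ≤ A → |b| ≤ A → |x| ≤ 1 → |y| ≤ 1 →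
      |s| ≤ |t| → ∀ i ≤ 2, ∀ j ≤ 2, ∀ n,
      |qExpCoeff q s n * (littleH a q x (n + i) * littleH b q y (n + j))| ≤ D n := by
  obtain ⟨δ, hδ, hδ1, hδt⟩ : ∃ δ : ℝ, 0 < δ ∧ δ ≤ 1 ∧ |t| * (1 + δ) ^ 2 < 1 := by
    have h0 := abs_nonneg t
    refine ⟨(1 - |t|) / 4, by linarith, by linarith, ?_⟩
    nlinarith [mul_nonneg h0 (sq_nonneg (1 - |t|)), mul_pos (sub_pos.2 ht) (sub_pos.2 ht)]
  refine ⟨_, summable_majorant hq hδ hA hδt, fun a b x y s ha hb hx hy hs i hi j hj n => ?_⟩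
  have m := growthBound_mono (q := q) hδ hA
  have h1 := (abs_littleH_le (q := q) hδ hδ1 ha hx (n + i)).trans (m (Nat.add_le_add_left hi n))
  have h2 := (abs_littleH_le (q := q) hδ hδ1 hb hy (n + j)).trans (m (Nat.add_le_add_left hj n))
  rw [abs_mul, abs_mul, sq]
  refine mul_le_mul ?_ (mul_le_mul h1 h2 (abs_nonneg _) ((abs_nonneg _).trans h1))
    (by positivity) (abs_nonneg _)
  rw [qExpCoeff, qExpCoeff, abs_div, abs_div, abs_pow, abs_pow]
  gcongr

lemma summable_bilinear {q t : ℝ} (hq : |q| < 1) (ht : |t| < 1) (a b : ℝ) {x y : ℝ}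
    (hx : |x| ≤ 1) (hy : |y| ≤ 1) {i j : ℕ} (hi : i ≤ 2) (hj : j ≤ 2) :
    Summable fun n => qExpCoeff q t n * (littleH a q x (n + i) * littleH b q y (n + j)) := by
  obtain ⟨D, hD, hb⟩ := exists_majorant hq ht (A := max |a| |b|)
    ((abs_nonneg a).trans (le_max_left _ _))
  exact Summable.of_norm_bounded hD fun n => hb a b x y t (le_max_left _ _) (le_max_right _ _)
    hx hy le_rfl i hi j hj n

/-! ### The two functional equations -/

/-- The bilinear sum `∑ t^n / (q;q)_n h_n(x|a,q) h_n(y|b,q)`. -/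
def bilinearSum (q t a b x y : ℝ) : ℝ :=
  ∑' n, qExpCoeff q t n * (littleH a q x n * littleH b q y n)

lemma bilinearSum_shift {q t : ℝ} (hq : |q| < 1) (ht : |t| < 1) (a : ℝ) {x y : ℝ}
    (hx : |x| ≤ 1) (hy : |y| ≤ 1) :
    bilinearSum q t a (t * a) x y =
      v y (t * a) * bilinearSum q t (a * q) (t * a * q) x y := by
  have htq : |t * q| < 1 := by
    rw [abs_mul]; exact mul_lt_one_of_nonneg_of_lt_one_left (abs_nonneg _) ht hq.le
  set b := t * a with hb
  set h := littleH (a * q) q x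
  set g := littleH (b * q) q y
  have hA : HasSum (fun n => qExpCoeff q t n * (h n * g n)) _ :=
    (summable_bilinear hq ht (a * q) (b * q) hx hy (i := 0) (j := 0)
      (by norm_num) (by norm_num)).hasSum
  have hB : HasSum (fun n => qExpCoeff q t n * (h (n + 1) * g n)) _ :=
    (summable_bilinear hq ht (a * q) (b * q) hx hy (i := 1) (j := 0)
      (by norm_num) (by norm_num)).hasSum
  have hC : HasSum (fun n => qExpCoeff q t n * (h n * g (n + 1))) _ :=
    (summable_bilinear hq ht (a * q) (b * q) hx hy (i := 0) (j := 1)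
      (by norm_num) (by norm_num)).hasSum
  have hE : HasSum (fun n => qExpCoeff q (t * q) n * (h n * g n)) _ :=
    (summable_bilinear hq htq (a * q) (b * q) hx hy (i := 0) (j := 0)
      (by norm_num) (by norm_num)).hasSum
  simp only [qExpCoeff_mul] at hE
  have hA' : bilinearSum q t (a * q) (b * q) x y = _ := hA.tsum_eq
  rw [hA']
  have hC' := ((hA.mul_left (2 * y)).sub (hE.mul_left (b * q))).sub
    (hasSum_shift hq (F := fun n => h (n + 1) * g n) hB)
  have eC := hC.unique (hC'.congr_fun fun n => by
    have e : g (n + 1) = (2 * y - b * q * q ^ n) * g n - (1 - q ^ n) * g (n - 1) :=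
      littleH_succ (b * q) q y n
    rw [e]
    cases n with
    | zero => simp; ring
    | succ n => simp only [Nat.add_sub_cancel]; ring)
  have hL := (((hA.sub ((hasSum_shift hq (F := fun n => h n * g (n + 1)) hC).mul_left a)).sub
    ((hasSum_shift hq (F := fun n => h (n + 1) * g n) hB).mul_left b))).add
    (((hasSum_shift hq (F := fun n => h n * g n) hA).sub
      ((hasSum_shift hq (F := fun n => q ^ (n + 1) * (h n * g n))
        ((hE.mul_left q).congr_fun fun n => by ring)))).mul_left (a * b))
  have hL' : bilinearSum q t a b x y = _ := (hL.congr_fun fun n => by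
    rw [littleH_eq_shift a q x n, littleH_eq_shift b q y n]
    change qExpCoeff q t n * ((h n - a * (1 - q ^ n) * h (n - 1)) *
      (g n - b * (1 - q ^ n) * g (n - 1))) = _
    cases n with
    | zero => simp
    | succ n => simp only [Nat.add_sub_cancel]; ring).tsum_eq
  -- Substituting `eC` for the sum of `h_n g_{n+1}` makes the sums `hB` and `hE` cancel, precisely
  -- because `b = t a`.
  rw [hL', v, eC]
  simp only [hb]
  ring

lemma bilinearSum_zero_shift {q t : ℝ} (hq : |q| < 1) (ht : |t| < 1) {x y : ℝ}
    (hx : |x| ≤ 1) (hy : |y| ≤ 1) :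
    w x y t * bilinearSum q t 0 0 x y =
      (1 - t ^ 2) * (1 - t ^ 2 * q) * bilinearSum q (t * q) 0 0 x y := by
  have htq : |t * q| < 1 := by
    rw [abs_mul]; exact mul_lt_one_of_nonneg_of_lt_one_left (abs_nonneg _) ht hq.le
  set h := littleH 0 q x
  set g := littleH 0 q y
  have rh : ∀ n, h (n + 1) = 2 * x * h n - (1 - q ^ n) * h (n - 1) := fun n => by
    simpa using littleH_succ 0 q x n
  have rg : ∀ n, g (n + 1) = 2 * y * g n - (1 - q ^ n) * g (n - 1) := fun n => by
    simpa using littleH_succ 0 q y n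
  have hA : HasSum (fun n => qExpCoeff q t n * (h n * g n)) _ :=
    (summable_bilinear hq ht 0 0 hx hy (i := 0) (j := 0) (by norm_num) (by norm_num)).hasSum
  have hB : HasSum (fun n => qExpCoeff q t n * (h (n + 1) * g n)) _ :=
    (summable_bilinear hq ht 0 0 hx hy (i := 1) (j := 0) (by norm_num) (by norm_num)).hasSum
  have hC : HasSum (fun n => qExpCoeff q t n * (h n * g (n + 1))) _ :=
    (summable_bilinear hq ht 0 0 hx hy (i := 0) (j := 1) (by norm_num) (by norm_num)).hasSum
  have hD : HasSum (fun n => qExpCoeff q t n * (h (n + 1) * g (n + 1))) _ :=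
    (summable_bilinear hq ht 0 0 hx hy (i := 1) (j := 1) (by norm_num) (by norm_num)).hasSum
  have hG : HasSum (fun n => qExpCoeff q t n * (h n * g (n + 2))) _ :=
    (summable_bilinear hq ht 0 0 hx hy (i := 0) (j := 2) (by norm_num) (by norm_num)).hasSum
  have hE : HasSum (fun n => qExpCoeff q (t * q) n * (h n * g n)) _ :=
    (summable_bilinear hq htq 0 0 hx hy (i := 0) (j := 0) (by norm_num) (by norm_num)).hasSum
  have hA' : bilinearSum q t 0 0 x y = _ := hA.tsum_eq
  have hE' : bilinearSum q (t * q) 0 0 x y = _ := hE.tsum_eq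
  rw [hA', hE']
  simp only [qExpCoeff_mul] at hE ⊢
  have eB := hB.unique (((hA.mul_left (2 * x)).sub
    (hasSum_shift hq (F := fun n => h n * g (n + 1)) hC)).congr_fun fun n => by
      rw [rh]
      cases n with
      | zero => simp; ring
      | succ n => simp only [Nat.add_sub_cancel]; ring)
  have eC := hC.unique (((hA.mul_left (2 * y)).sub
    (hasSum_shift hq (F := fun n => h (n + 1) * g n) hB)).congr_fun fun n => by
      rw [rg]
      cases n with
      | zero => simp; ring
      | succ n => simp only [Nat.add_sub_cancel]; ring)
  have eD := hD.unique (((hC.mul_left (2 * x)).sub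
    (hasSum_shift hq (F := fun n => h n * g (n + 2)) hG)).congr_fun fun n => by
      rw [rh]
      cases n with
      | zero => simp; ring
      | succ n => simp only [Nat.add_sub_cancel]; ring)
  have eG := hG.unique ((((hC.mul_left (2 * y)).sub hA).add (hE.mul_left q)).congr_fun
    fun n => by
      rw [rg (n + 1)]
      simp only [Nat.add_sub_cancel]; ring)
  have eE := hE.unique ((hA.sub
    (hasSum_shift hq (F := fun n => h (n + 1) * g (n + 1)) hD)).congr_fun fun n => by
      cases n with
      | zero => simp
      | succ n => simp only [Nat.add_sub_cancel]; ring)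
  generalize (∑' n, qExpCoeff q t n * (h (n + 0) * g (n + 0))) = A at *
  generalize (∑' n, qExpCoeff q t n * (h (n + 1) * g (n + 0))) = B at *
  generalize (∑' n, qExpCoeff q t n * (h (n + 0) * g (n + 1))) = C at *
  generalize (∑' n, qExpCoeff q t n * (h (n + 1) * g (n + 1))) = D at *
  generalize (∑' n, qExpCoeff q t n * (h (n + 0) * g (n + 2))) = G at *
  generalize (∑' n, qExpCoeff q t n * q ^ n * (h (n + 0) * g (n + 0))) = E at *
  rw [w]
  -- `eE`, `eD`, `eG` give `(1-t²q)E = (1-t²)A - 2t(x-yt)C`, and `eC`, `eB` give `(1-t²)C =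
  -- 2(y-tx)A`; the weights eliminate `C`.
  linear_combination -(1 - t ^ 2) * (eE - t * eD + t ^ 2 * eG) +
    2 * t * (x - y * t) * (eC - t * eB)

/-! ### Positivity of the factors and convergence of the products -/

lemma v_lower_bound {c t : ℝ} (hc : |c| ≤ 1) : (1 - |t|) ^ 2 ≤ v c t := by
  have : t * c ≤ |t| := (le_abs_self _).trans (by
    rw [abs_mul]; exact mul_le_of_le_one_right (abs_nonneg t) hc)
  rw [v]; nlinarith [sq_abs t]

/-- With `x = cos θ`, `y = cos φ`, the two factors are `|1 - t e^{i(θ+φ)}|²` and `|1 - t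
e^{i(θ-φ)}|²`. -/
lemma w_eq_mul_v {x y : ℝ} (hx : |x| ≤ 1) (hy : |y| ≤ 1) (t : ℝ) :
    w x y t = v (Real.cos (Real.arccos x + Real.arccos y)) t *
      v (Real.cos (Real.arccos x - Real.arccos y)) t := by
  obtain ⟨hx1, hx2⟩ := abs_le.1 hx
  obtain ⟨hy1, hy2⟩ := abs_le.1 hy
  rw [Real.cos_add, Real.cos_sub, Real.cos_arccos hx1 hx2, Real.cos_arccos hy1 hy2, w, v, v]
  have h1 := Real.sin_sq_add_cos_sq (Real.arccos x)
  have h2 := Real.sin_sq_add_cos_sq (Real.arccos y)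
  rw [Real.cos_arccos hx1 hx2] at h1
  rw [Real.cos_arccos hy1 hy2] at h2
  linear_combination 4 * t ^ 2 * Real.sin (Real.arccos y) ^ 2 * h1 + 4 * t ^ 2 * (1 - x ^ 2) * h2

lemma w_lower_bound {x y t : ℝ} (hx : |x| ≤ 1) (hy : |y| ≤ 1) :
    ((1 - |t|) ^ 2) ^ 2 ≤ w x y t := by
  rw [w_eq_mul_v hx hy, sq ((1 - |t|) ^ 2)]
  exact mul_le_mul (v_lower_bound (Real.abs_cos_le_one _)) (v_lower_bound (Real.abs_cos_le_one _))
    (by positivity) ((sq_nonneg _).trans (v_lower_bound (Real.abs_cos_le_one _)))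

lemma w_pos {x y t : ℝ} (hx : |x| ≤ 1) (hy : |y| ≤ 1) (ht : |t| < 1) : 0 < w x y t :=
  lt_of_lt_of_le (by have := sub_pos.2 ht; positivity) (w_lower_bound hx hy)

/-- Differentiability at `0` gives `f z - 1 = O(z)`, so the factors are `1 + O(|q|^k)`. -/
lemma multipliable_of_differentiable {f : ℝ → ℝ} (hf : DifferentiableAt ℝ f 0) (h0 : f 0 = 1)
    {q : ℝ} (hq : |q| < 1) (c : ℝ) : Multipliable fun k : ℕ => f (c * q ^ k) := by
  have hs : Summable fun k : ℕ => f (c * q ^ k) - 1 := by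
    have lim : Tendsto (fun k : ℕ => c * q ^ k) atTop (𝓝 0) := by
      simpa using (tendsto_pow_atTop_nhds_zero_of_abs_lt_one hq).const_mul c
    have hO := (hf.isBigO_sub).comp_tendsto lim
    simp only [h0, sub_zero, Function.comp_def] at hO
    exact summable_of_isBigO_nat
      (((summable_geometric_of_lt_one (abs_nonneg q) hq).mul_left |c|))
      (hO.trans (Asymptotics.isBigO_of_le _ fun k => by simp))
  simpa using multipliable_one_add_of_summable hs.norm

lemma multipliable_one_sub {q : ℝ} (hq : |q| < 1) (c : ℝ) :
    Multipliable fun k : ℕ => 1 - c * q ^ k :=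
  multipliable_of_differentiable (f := fun z => 1 - z) (by fun_prop) (by simp) hq c

lemma multipliable_v {q : ℝ} (hq : |q| < 1) (y c : ℝ) :
    Multipliable fun k : ℕ => v y (c * q ^ k) :=
  multipliable_of_differentiable (f := v y) (by unfold v; fun_prop) (by simp [v]) hq c

lemma multipliable_w_inv {q : ℝ} (hq : |q| < 1) (x y c : ℝ) :
    Multipliable fun k : ℕ => (w x y (c * q ^ k))⁻¹ :=
  multipliable_of_differentiable (f := fun z => (w x y z)⁻¹)
    (DifferentiableAt.inv (by unfold w; fun_prop) (by simp [w])) (by simp [w]) hq c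

lemma abs_mul_pow_le {q : ℝ} (hq : |q| < 1) (c : ℝ) (k : ℕ) : |c * q ^ k| ≤ |c| := by
  rw [abs_mul, abs_pow]
  exact mul_le_of_le_one_right (abs_nonneg c) (pow_le_one₀ (abs_nonneg q) hq.le)

/-! ### Iteration of the functional equations -/

lemma tendsto_bilinearSum {q t : ℝ} (hq : |q| < 1) (ht : |t| < 1) {x y : ℝ}
    (hx : |x| ≤ 1) (hy : |y| ≤ 1) {A : ℝ} {s a b : ℕ → ℝ} {s₀ a₀ b₀ : ℝ}
    (hs : ∀ k, |s k| ≤ |t|) (ha : ∀ k, |a k| ≤ A) (hb : ∀ k, |b k| ≤ A)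
    (hs' : Tendsto s atTop (𝓝 s₀)) (ha' : Tendsto a atTop (𝓝 a₀)) (hb' : Tendsto b atTop (𝓝 b₀)) :
    Tendsto (fun k => bilinearSum q (s k) (a k) (b k) x y) atTop
      (𝓝 (bilinearSum q s₀ a₀ b₀ x y)) := by
  obtain ⟨D, hD, hb2⟩ := exists_majorant hq ht ((abs_nonneg _).trans (ha 0))
  refine tendsto_tsum_of_dominated_convergence hD (fun n => ?_) (Eventually.of_forall fun k n =>
    hb2 (a k) (b k) x y (s k) (ha k) (hb k) hx hy (hs k) 0 (by norm_num) 0 (by norm_num) n)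
  refine Tendsto.mul ?_ (Tendsto.mul ?_ ?_)
  · exact (hs'.pow n).div_const _
  · exact ((continuous_littleH q x n).tendsto a₀).comp ha'
  · exact ((continuous_littleH q y n).tendsto b₀).comp hb'

lemma tendsto_const_mul_pow {q : ℝ} (hq : |q| < 1) (c : ℝ) :
    Tendsto (fun k : ℕ => c * q ^ k) atTop (𝓝 0) := by
  simpa using (tendsto_pow_atTop_nhds_zero_of_abs_lt_one hq).const_mul c

lemma bilinearSum_eq_tprod_mul {q t : ℝ} (hq : |q| < 1) (ht : |t| < 1) (a : ℝ) {x y : ℝ}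
    (hx : |x| ≤ 1) (hy : |y| ≤ 1) :
    bilinearSum q t a (t * a) x y =
      (∏' k : ℕ, v y (t * a * q ^ k)) * bilinearSum q t 0 0 x y := by
  have iter : ∀ N : ℕ, bilinearSum q t a (t * a) x y =
      (∏ k ∈ Finset.range N, v y (t * a * q ^ k)) *
        bilinearSum q t (a * q ^ N) (t * a * q ^ N) x y := by
    intro N
    induction N with
    | zero => simp
    | succ N ih =>
      -- The relation `b = t a` survives multiplying both parameters by `q^N`, so the shift can be
      -- repeated.
      have := bilinearSum_shift hq ht (a * q ^ N) hx hy
      rw [ih, Finset.prod_range_succ, mul_assoc t a, this]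
      simp only [pow_succ, mul_assoc]
  have lim := (multipliable_v hq y (t * a)).tendsto_prod_tprod_nat.mul
    (tendsto_bilinearSum hq ht hx hy (A := max |a| |t * a|) (fun _ => le_rfl)
      (fun k => (abs_mul_pow_le hq a k).trans (le_max_left _ _))
      (fun k => (abs_mul_pow_le hq (t * a) k).trans (le_max_right _ _))
      tendsto_const_nhds (tendsto_const_mul_pow hq a) (tendsto_const_mul_pow hq (t * a)))
  exact tendsto_nhds_unique (tendsto_const_nhds.congr iter) lim

lemma bilinearSum_zero_left (q a b x y : ℝ) : bilinearSum q 0 a b x y = 1 := by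
  rw [bilinearSum, tsum_eq_single 0 fun n hn => by simp [qExpCoeff, hn]]
  simp [qExpCoeff, littleH]

/-- The `q`-Mehler formula. -/
lemma bilinearSum_zero_eq {q t : ℝ} (hq : |q| < 1) (ht : |t| < 1) {x y : ℝ}
    (hx : |x| ≤ 1) (hy : |y| ≤ 1) :
    bilinearSum q t 0 0 x y =
      qPochhammerInf (t ^ 2) q * ∏' k : ℕ, (w x y (t * q ^ k))⁻¹ := by
  -- Each step yields two Pochhammer factors, with exponents `2N` and `2N + 1` because `(t q^N)² =
  -- t² q^{2N}`; hence the range `2 * N`.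
  have iter : ∀ N : ℕ, bilinearSum q t 0 0 x y =
      (∏ k ∈ Finset.range (2 * N), (1 - t ^ 2 * q ^ k)) *
        (∏ k ∈ Finset.range N, (w x y (t * q ^ k))⁻¹) *
        bilinearSum q (t * q ^ N) 0 0 x y := by
    intro N
    induction N with
    | zero => simp
    | succ N ih =>
      have htN : |t * q ^ N| < 1 := (abs_mul_pow_le hq t N).trans_lt ht
      have hw := (w_pos hx hy htN).ne'
      have e := bilinearSum_zero_shift hq htN hx hy
      rw [mul_comm, ← eq_div_iff hw] at e
      rw [ih, e, show 2 * (N + 1) = 2 * N + 1 + 1 by ring, Finset.prod_range_succ _ (2 * N + 1),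
        Finset.prod_range_succ _ (2 * N), Finset.prod_range_succ _ N, div_eq_mul_inv,
        pow_succ q N, ← mul_assoc t]
      ring
  have lim := (((multipliable_one_sub hq (t ^ 2)).tendsto_prod_tprod_nat.comp
    (tendsto_id.const_mul_atTop' (zero_lt_two (α := ℕ)))).mul
    (multipliable_w_inv hq x y t).tendsto_prod_tprod_nat).mul
    (tendsto_bilinearSum hq ht hx hy (A := 0) (a := fun _ => 0) (b := fun _ => 0)
      (fun k => abs_mul_pow_le hq t k) (by simp) (by simp) (tendsto_const_mul_pow hq t)
      tendsto_const_nhds tendsto_const_nhds)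
  rw [bilinearSum_zero_left, mul_one] at lim
  exact tendsto_nhds_unique (tendsto_const_nhds.congr iter) lim

/-! ### Rescaling to `S(q)` -/

lemma abs_rescale_le {q x : ℝ} (hq : q < 1) (hx : x ∈ S q) : |x * √(1 - q) / 2| ≤ 1 := by
  have hs : 0 < √(1 - q) := Real.sqrt_pos.2 (sub_pos.2 hq)
  obtain ⟨h1, h2⟩ := hx
  rw [div_le_iff₀ hs] at h1
  rw [le_div_iff₀ hs] at h2
  rw [abs_le]
  constructor <;> linarith

lemma qFactorial_mul_pow (q : ℝ) (n : ℕ) :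
    qFactorial q n * (1 - q) ^ n = ∏ j ∈ Finset.range n, (1 - q ^ (j + 1)) := by
  rw [qFactorial, ← Finset.card_range n, ← Finset.prod_const, Finset.card_range,
    ← Finset.prod_mul_distrib]
  exact Finset.prod_congr rfl fun j _ => geom_sum_mul_neg q (j + 1)

lemma kernelTerm_eq {q : ℝ} (hq : q < 1) (a b x y : ℝ) (n : ℕ) :
    kernelTerm q a b x y n = qExpCoeff q (b / a) n *
      (littleH (a * √(1 - q)) q (x * √(1 - q) / 2) n *
        littleH (b * √(1 - q)) q (y * √(1 - q) / 2) n) := by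
  have h : (√(1 - q) ^ n)⁻¹ * (√(1 - q) ^ n)⁻¹ = ((1 - q) ^ n)⁻¹ := by
    rw [← mul_inv, ← mul_pow, Real.mul_self_sqrt (sub_pos.2 hq).le]
  rw [kernelTerm, bigH, bigH, qExpCoeff, ← qFactorial_mul_pow, div_pow]
  simp only [div_eq_mul_inv, mul_inv, ← h]
  ring

lemma v_nonneg {c : ℝ} (hc : |c| ≤ 1) (t : ℝ) : 0 ≤ v c t :=
  (sq_nonneg _).trans (v_lower_bound hc)

lemma tprod_nonneg_of_multipliable {f : ℕ → ℝ} (hf : Multipliable f) (h : ∀ k, 0 ≤ f k) :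
    0 ≤ ∏' k, f k :=
  ge_of_tendsto' hf.tendsto_prod_tprod_nat fun _ => Finset.prod_nonneg fun k _ => h k

end BigQHermite

end

theorem mainTheorem3 (q a b x y : ℝ) (hq : |q| < 1) (hab : |b| < |a|)
    (hx : x ∈ BigQHermite.S q) (hy : y ∈ BigQHermite.S q) :
    -- the closed form is meaningful: denominators do not vanish, the products converge
    (∀ k : ℕ, BigQHermite.W q x y (b / a * q ^ k) ≠ 0) ∧
    Multipliable (fun k : ℕ => 1 - b ^ 2 / a ^ 2 * q ^ k) ∧
    Multipliable (fun k : ℕ =>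
      BigQHermite.V q y (b * q ^ k) / BigQHermite.W q x y (b / a * q ^ k)) ∧
    -- the kernel converges, is nonnegative, and has the closed form
    Summable (BigQHermite.kernelTerm q a b x y) ∧
    0 ≤ ∑' n : ℕ, BigQHermite.kernelTerm q a b x y n ∧
    ∑' n : ℕ, BigQHermite.kernelTerm q a b x y n =
      BigQHermite.qPochhammerInf (b ^ 2 / a ^ 2) q *
        ∏' k : ℕ, BigQHermite.V q y (b * q ^ k) / BigQHermite.W q x y (b / a * q ^ k) := by
  have hq1 : q < 1 := (abs_lt.1 hq).2
  have ha : a ≠ 0 := abs_pos.1 ((abs_nonneg b).trans_lt hab)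
  have ht : |b / a| < 1 := by rwa [abs_div, div_lt_one (abs_pos.2 ha)]
  have hx' := BigQHermite.abs_rescale_le hq1 hx
  have hy' := BigQHermite.abs_rescale_le hq1 hy
  set X := x * √(1 - q) / 2 with hX
  set Y := y * √(1 - q) / 2 with hY
  have htk := fun k : ℕ => (BigQHermite.abs_mul_pow_le hq (b / a) k).trans_lt ht
  have hwpos := fun k : ℕ => BigQHermite.w_pos hx' hy' (htk k)
  -- The rescaled parameters satisfy the coupling `b = t a` with `t = b/a`.
  have hb : b / a * (a * √(1 - q)) = b * √(1 - q) := by field_simp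
  have hVW : (fun k : ℕ =>
      BigQHermite.V q y (b * q ^ k) / BigQHermite.W q x y (b / a * q ^ k)) =
      fun k : ℕ => BigQHermite.v Y (b * √(1 - q) * q ^ k) *
        (BigQHermite.w X Y (b / a * q ^ k))⁻¹ := by
    funext k
    rw [BigQHermite.V, BigQHermite.W, div_eq_mul_inv, mul_right_comm b]
  have hker : BigQHermite.kernelTerm q a b x y = fun n => BigQHermite.qExpCoeff q (b / a) n *
      (BigQHermite.littleH (a * √(1 - q)) q X n * BigQHermite.littleH (b * √(1 - q)) q Y n) :=
    funext fun n => BigQHermite.kernelTerm_eq hq1 a b x y n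
  have hmV := BigQHermite.multipliable_v hq Y (b * √(1 - q))
  have hmW := BigQHermite.multipliable_w_inv hq X Y (b / a)
  have hmP := BigQHermite.multipliable_one_sub hq ((b / a) ^ 2)
  have hsum : ∑' n : ℕ, BigQHermite.kernelTerm q a b x y n =
      BigQHermite.qPochhammerInf (b ^ 2 / a ^ 2) q *
        ∏' k : ℕ, BigQHermite.V q y (b * q ^ k) / BigQHermite.W q x y (b / a * q ^ k) := by
    have h1 := BigQHermite.bilinearSum_eq_tprod_mul hq ht (a * √(1 - q)) hx' hy'
    rw [BigQHermite.bilinearSum_zero_eq hq ht hx' hy', hb] at h1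
    rw [hVW, hker, hmV.tprod_mul hmW, ← div_pow]
    exact h1.trans (mul_left_comm _ _ _)
  refine ⟨fun k => (hwpos k).ne', by simpa only [div_pow] using hmP, hVW ▸ hmV.mul hmW, ?_, ?_, hsum⟩
  · rw [hker]
    exact BigQHermite.summable_bilinear hq ht _ _ hx' hy' (i := 0) (j := 0)
      (by norm_num) (by norm_num)
  · rw [hsum, hVW, ← div_pow]
    refine mul_nonneg (BigQHermite.tprod_nonneg_of_multipliable hmP fun k => ?_)
      (BigQHermite.tprod_nonneg_of_multipliable (hmV.mul hmW) fun k =>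
        mul_nonneg (BigQHermite.v_nonneg hy' _) (inv_nonneg.2 (hwpos k).le))
    refine sub_nonneg.2 ((le_abs_self _).trans ((BigQHermite.abs_mul_pow_le hq _ k).trans ?_))
    rw [abs_pow]
    exact pow_le_one₀ (abs_nonneg _) ht.le
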